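/- Let $X, X'$ be random variables with values in a common standard Borel space $E$ and let $Y$ be a random variable with values in a standard Borel space $F$, all defined on the same measurable space $\Omega$ (for instance a standard probability space). Let $\mu,\nu$ be two probability measures on $\Omega$. Write $\mu^X$ for the law of $X$ under $\mu$, write $\mu^{Y\mid X=x}$ for the regular conditional law of $Y$ given $X=x$ under $\mu$, and similarly for the other random variables and for $\nu$. Let $\mathscr C(\mu^X,\mu^{X'})$ be the set of couplings of $\mu^X$ and $\mu^{X'}$, i.e. of probability measures on $E\times E$ with first marginal $\mu^X$ and second marginal $\mu^{X'}$. For probability measures $P,Q$ on the same space and $q\in(0,\infty]$, the Rényi divergence $\mathsf R_q(P\,\|\,Q)\in[0,\infty]$ is defined as follows. If $P\ll Q$, then $$\mathsf R_q(P\,\|\,Q)=\frac1{q-1}\log\int\Bigl(\frac{dP}{dQ}\Bigr)^q\,dQ\quad(q\ne 1,\infty),\qquad \mathsf R_\infty(P\,\|\,Q)=\log\Bigl\|\frac{dP}{dQ}\Bigr\|_{L^\infty(Q)},$$ and $\mathsf R_1(P\,\|\,Q)=\mathsf{KL}(P\,\|\,Q)=\int \frac{dP}{dQ}\log\frac{dP}{dQ}\,dQ$.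 If $P\not\ll Q$, then $\mathsf R_q(P\,\|\,Q)=+\infty$ for $q\ge 1$, and $\mathsf R_q(P\,\|\,Q)=\frac1{q-1}\log\int(\frac{dP}{d\lambda})^q(\frac{dQ}{d\lambda})^{1-q}\,d\lambda$ with $\lambda=P+Q$ for $q<1$ (with $\log 0=-\infty$). 1. (Shifted chain rule) It holds that $$\mathsf{KL}(\mu^Y\,\|\,\nu^Y)\le \mathsf{KL}(\mu^{X'}\,\|\,\nu^X)+\inf_{\gamma\in\mathscr C(\mu^X,\mu^{X'})}\int \mathsf{KL}(\mu^{Y\mid X=x}\,\|\,\nu^{Y\mid X=x'})\,\gamma(dx,dx').$$ 2. (Shifted composition rule) Let $q\in(0,\infty]$. If $q\in(0,1)$, assume in addition that $\mu^{X'}\ll\nu^X$. Then $$\mathsf R_q(\mu^Y\,\|\,\nu^Y)\le \mathsf R_q(\mu^{X'}\,\|\,\nu^X)+\inf_{\gamma\in\mathscr C(\mu^X,\mu^{X'})}\ \operatorname*{ess\,sup}_{(x,x')\sim\gamma}\ \mathsf R_q(\mu^{Y\mid X=x}\,\|\,\nu^{Y\mid X=x'}).$$ -/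

import Mathlib

open MeasureTheory ProbabilityTheory InformationTheory
open scoped ENNReal

noncomputable section

/-- The set of couplings of `μ` and `ν`: probability measures on the product space with first
marginal `μ` and second marginal `ν`. -/
def couplings {α β : Type*} [MeasurableSpace α] [MeasurableSpace β]
    (μ : Measure α) (ν : Measure β) : Set (Measure (α × β)) :=
  {γ | IsProbabilityMeasure γ ∧ γ.map Prod.fst = μ ∧ γ.map Prod.snd = ν}

open scoped Classical in
/-- The Rényi divergence of order `q ∈ (0, ∞]` between two probability measures, with values in the
extended reals. `ENNReal.log` is the logarithm `[0, ∞] → [-∞, ∞]`. For `q = 1` it is the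
Kullback-Leibler divergence. If `μ` is not absolutely continuous with respect to `ν`, it is `+∞`
for `q ≥ 1`, and for `q < 1` it is computed with the common dominating measure `μ + ν`. -/
def renyiDiv {α : Type*} [MeasurableSpace α] (q : ℝ≥0∞) (μ ν : Measure α) : EReal :=
  if q = 1 then (klDiv μ ν : EReal)
  else if q = ∞ then
    if μ ≪ ν then ENNReal.log (essSup (μ.rnDeriv ν) ν) else ⊤
  else if μ ≪ ν then
    (((q.toReal - 1)⁻¹ : ℝ) : EReal) * ENNReal.log (∫⁻ x, (μ.rnDeriv ν x) ^ q.toReal ∂ν)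
  else if 1 < q then ⊤
  else
    (((q.toReal - 1)⁻¹ : ℝ) : EReal) * ENNReal.log
      (∫⁻ x, (μ.rnDeriv (μ + ν) x) ^ q.toReal * (ν.rnDeriv (μ + ν) x) ^ (1 - q.toReal) ∂(μ + ν))

end

/-! Disintegration writes the laws of `Y` as mixtures `κ ∘ₘ P` and `η ∘ₘ Q`, where `T` is the law of
`X'` under `μ`. Each divergence has a variational formula over test functions `f`. Fix `f` on the
target space, integrate it against `κ x` and `η x'`, compare the results pointwise under a coupling
`γ` of `P` and `T`, then use a function of `x'` as test function for `T` against `Q`.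

For KL, with `a x = ∫ f dκ x` and `b x' = ∫ exp f dη x'`, the functional `∫ f - ∫ exp f + 1` splits
into `∫ (a x - log (b x')) dγ`, bounded by Donsker-Varadhan for each pair, and the same functional
of `log b` for `T` and `Q`.

For finite `q ≠ 1` the test inequality is Hölder's, with `∫ (dP/dQ)^q dQ` as optimal constant: an
upper bound for `q > 1`, an infimum for `q < 1`. For `q = ∞` indicators of sets suffice. These
constants multiply along the composition, so their logarithms add. -/

/-! ### Integration against a coupling -/

section Coupling

variable {α β δ : Type*} [MeasurableSpace α] [MeasurableSpace β] [MeasurableSpace δ]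

lemma lintegral_fst_coupling {P : Measure α} {T : Measure β} {γ : Measure (α × β)}
    (hγ : γ ∈ couplings P T) {f : α → ℝ≥0∞} (hf : Measurable f) :
    ∫⁻ p, f p.1 ∂γ = ∫⁻ x, f x ∂P := by
  rw [← hγ.2.1, lintegral_map hf measurable_fst]

lemma lintegral_snd_coupling {P : Measure α} {T : Measure β} {γ : Measure (α × β)}
    (hγ : γ ∈ couplings P T) {f : β → ℝ≥0∞} (hf : Measurable f) :
    ∫⁻ p, f p.2 ∂γ = ∫⁻ x, f x ∂T := by
  rw [← hγ.2.2, lintegral_map hf measurable_snd]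

lemma ae_fst_coupling {P : Measure α} {T : Measure β} {γ : Measure (α × β)}
    (hγ : γ ∈ couplings P T) {p : α → Prop} (h : ∀ᵐ x ∂P, p x) : ∀ᵐ z ∂γ, p z.1 := by
  rw [← hγ.2.1] at h
  exact ae_of_ae_map measurable_fst.aemeasurable h

lemma ae_snd_coupling {P : Measure α} {T : Measure β} {γ : Measure (α × β)}
    (hγ : γ ∈ couplings P T) {p : β → Prop} (h : ∀ᵐ x ∂T, p x) : ∀ᵐ z ∂γ, p z.2 := by
  rw [← hγ.2.2] at h
  exact ae_of_ae_map measurable_snd.aemeasurable h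

lemma lintegral_kernel_comp_fst_coupling {P : Measure α} {T : Measure β} {γ : Measure (α × β)}
    (hγ : γ ∈ couplings P T) (κ : Kernel α δ) {f : δ → ℝ≥0∞} (hf : Measurable f) :
    ∫⁻ p, ∫⁻ y, f y ∂κ p.1 ∂γ = ∫⁻ y, f y ∂(κ ∘ₘ P) := by
  rw [Measure.lintegral_bind κ.aemeasurable hf.aemeasurable]
  exact lintegral_fst_coupling hγ hf.lintegral_kernel

end Coupling

/-! ### Variational formula and shifted chain rule for KL -/

section KullbackLeibler

variable {α : Type*} [MeasurableSpace α]

/-- Fenchel-Young inequality for the conjugate pair `klFun`, `exp t - 1`; it is `1 + u ≤ exp u` at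
`u = t - log s`. -/
lemma mul_sub_exp_add_one_le_klFun {s : ℝ} (hs : 0 ≤ s) (t : ℝ) :
    s * t - Real.exp t + 1 ≤ klFun s := by
  rw [klFun_apply]
  rcases hs.eq_or_lt with rfl | hs
  · simp [(Real.exp_pos t).le]
  · have h1 := Real.add_one_le_exp (t - Real.log s)
    rw [Real.exp_sub, Real.exp_log hs, le_div_iff₀ hs] at h1
    nlinarith

lemma integrable_of_bound {P : Measure α} [IsFiniteMeasure P] {f : α → ℝ} (hf : Measurable f)
    {C : ℝ} (hC : ∀ x, |f x| ≤ C) : Integrable f P :=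
  Integrable.of_bound hf.aestronglyMeasurable C
    (ae_of_all _ fun x ↦ (Real.norm_eq_abs _).trans_le (hC x))

lemma integrable_exp_of_bound {P : Measure α} [IsFiniteMeasure P] {f : α → ℝ} (hf : Measurable f)
    {C : ℝ} (hC : ∀ x, |f x| ≤ C) : Integrable (fun x ↦ Real.exp (f x)) P :=
  integrable_of_bound (by fun_prop) (C := Real.exp C) fun x ↦ by
    rw [abs_of_pos (Real.exp_pos _)]
    exact Real.exp_le_exp.2 ((le_abs_self _).trans (hC x))

/-- The variational lower bound for the Kullback-Leibler divergence. -/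
lemma ofReal_integral_sub_integral_exp_le_klDiv (P Q : Measure α) [IsProbabilityMeasure P]
    [IsProbabilityMeasure Q] {f : α → ℝ} (hf : Measurable f) {C : ℝ} (hC : ∀ x, |f x| ≤ C) :
    ENNReal.ofReal (∫ x, f x ∂P - ∫ x, Real.exp (f x) ∂Q + 1) ≤ klDiv P Q := by
  by_cases htop : klDiv P Q = ∞
  · simp [htop]
  obtain ⟨hac, hint⟩ := klDiv_ne_top_iff.1 htop
  rw [← ENNReal.ofReal_toReal htop, toReal_klDiv_eq_integral_klFun hac]
  refine ENNReal.ofReal_le_ofReal ?_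
  have hP : Integrable f P := integrable_of_bound hf hC
  have hQ : Integrable (fun x ↦ Real.exp (f x)) Q := integrable_exp_of_bound hf hC
  have hI : Integrable (fun x ↦ (P.rnDeriv Q x).toReal * f x) Q := by
    simpa using (integrable_rnDeriv_smul_iff hac).2 hP
  have h1 : ∫ x, f x ∂P = ∫ x, (P.rnDeriv Q x).toReal * f x ∂Q := by
    simpa using (integral_rnDeriv_smul hac (f := f)).symm
  have hS : Integrable (fun x ↦ (P.rnDeriv Q x).toReal * f x - Real.exp (f x)) Q := hI.sub hQ
  calc ∫ x, f x ∂P - ∫ x, Real.exp (f x) ∂Q + 1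
      = ∫ x, ((P.rnDeriv Q x).toReal * f x - Real.exp (f x) + 1) ∂Q := by
        rw [integral_add hS (integrable_const _), integral_sub hI hQ, h1]
        simp
    _ ≤ _ := by
        refine integral_mono (hS.add (integrable_const _))
          ((integrable_klFun_rnDeriv_iff hac).2 hint) fun x ↦ ?_
        exact mul_sub_exp_add_one_le_klFun ENNReal.toReal_nonneg _

/-- The Donsker-Varadhan lower bound for the Kullback-Leibler divergence. -/
lemma ofReal_integral_sub_log_integral_exp_le_klDiv (P Q : Measure α) [IsProbabilityMeasure P]
    [IsProbabilityMeasure Q] {f : α → ℝ} (hf : Measurable f) {C : ℝ} (hC : ∀ x, |f x| ≤ C) :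
    ENNReal.ofReal (∫ x, f x ∂P - Real.log (∫ x, Real.exp (f x) ∂Q)) ≤ klDiv P Q := by
  set c := Real.log (∫ x, Real.exp (f x) ∂Q) with hc
  have hpos : 0 < ∫ x, Real.exp (f x) ∂Q := integral_exp_pos (integrable_exp_of_bound hf hC)
  -- Shifting by `c` normalises `∫ exp (f - c) dQ` to `1`, so the last two terms cancel.
  have h := ofReal_integral_sub_integral_exp_le_klDiv P Q (f := fun x ↦ f x - c)
    (by fun_prop) (C := C + |c|) (fun x ↦ (abs_sub _ _).trans (by gcongr; exact hC x))
  convert h using 2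
  rw [integral_sub (integrable_of_bound hf hC) (integrable_const _)]
  simp only [Real.exp_sub, integral_div]
  rw [hc, Real.exp_log hpos, div_self hpos.ne']
  simp

/-- The logarithm clamped to `[-n, n]`, with `log 0 = -∞` clamped to `-n`. -/
noncomputable def clampLog (n : ℕ) (s : ℝ) : ℝ :=
  if s = 0 then -n else max (-n) (min n (Real.log s))

lemma measurable_clampLog (n : ℕ) : Measurable (clampLog n) :=
  Measurable.ite (measurableSet_singleton 0) measurable_const (by fun_prop)

lemma abs_clampLog_le (n : ℕ) (s : ℝ) : |clampLog n s| ≤ n := by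
  unfold clampLog
  split_ifs
  · simp
  · rw [abs_le]
    exact ⟨le_max_left _ _, max_le (by linarith [n.cast_nonneg (α := ℝ)]) (min_le_left _ _)⟩

/-- The concave map `t ↦ s * t - exp t + 1` vanishes at `0` and peaks at `log s`; clamping stays
between the two. Nonnegativity is what Fatou's lemma needs later. -/
lemma mul_clampLog_sub_exp_nonneg (n : ℕ) {s : ℝ} (hs : 0 ≤ s) :
    0 ≤ s * clampLog n s - Real.exp (clampLog n s) + 1 := by
  have hn := n.cast_nonneg (α := ℝ)
  rcases hs.eq_or_lt with rfl | hs
  · simp [clampLog]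
  have hk := klFun_nonneg (Real.exp_pos (clampLog n s)).le
  rw [klFun_apply, Real.log_exp] at hk
  have key : Real.exp (clampLog n s) * clampLog n s ≤ s * clampLog n s := by
    simp only [clampLog, hs.ne', if_false]
    rcases le_total 0 (Real.log s) with h | h
    · have ht : 0 ≤ min (n : ℝ) (Real.log s) := le_min hn h
      rw [max_eq_right (by linarith)]
      refine mul_le_mul_of_nonneg_right ?_ ht
      rw [← Real.le_log_iff_exp_le hs]
      exact min_le_right _ _
    · rw [min_eq_right (h.trans hn)]
      refine mul_le_mul_of_nonpos_right ?_ (max_le (by linarith) h)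
      rw [← Real.log_le_iff_le_exp hs]
      exact le_max_right _ _
  linarith

lemma tendsto_mul_clampLog_sub_exp {s : ℝ} (hs : 0 ≤ s) :
    Filter.Tendsto (fun n ↦ s * clampLog n s - Real.exp (clampLog n s) + 1) Filter.atTop
      (nhds (klFun s)) := by
  rcases hs.eq_or_lt with rfl | hs
  · have h : Filter.Tendsto (fun n : ℕ ↦ Real.exp (-(n : ℝ))) Filter.atTop (nhds 0) :=
      Real.tendsto_exp_neg_atTop_nhds_zero.comp tendsto_natCast_atTop_atTop
    simpa [clampLog, klFun_zero] using (h.neg.add_const 1)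
  · refine tendsto_const_nhds.congr' ?_
    filter_upwards [Filter.eventually_ge_atTop ⌈|Real.log s|⌉₊] with n hn
    have hn' : |Real.log s| ≤ n := (Nat.le_ceil _).trans (by exact_mod_cast hn)
    rw [abs_le] at hn'
    simp only [clampLog, hs.ne', if_false, min_eq_right hn'.2, max_eq_right hn'.1,
      Real.exp_log hs, klFun_apply]
    ring

/-- The Kullback-Leibler divergence is bounded by every bound for its variational formula. -/
lemma klDiv_le_of_forall_ofReal_le (P Q : Measure α) [IsProbabilityMeasure P]
    [IsProbabilityMeasure Q] {K : ℝ≥0∞}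
    (h : ∀ f : α → ℝ, Measurable f → ∀ C, (∀ x, |f x| ≤ C) →
      ENNReal.ofReal (∫ x, f x ∂P - ∫ x, Real.exp (f x) ∂Q + 1) ≤ K) :
    klDiv P Q ≤ K := by
  by_cases hK : K = ∞
  · simp [hK]
  have hac : P ≪ Q := by
    -- On a `Q`-null set `s` with `P s > 0`, the test function `n * 1_s` gives `n * P s ≤ K`, false
    -- for large `n`.
    refine Measure.AbsolutelyContinuous.mk fun s hs hQs ↦ ?_
    by_contra hPs
    have hpos : 0 < P.real s := ENNReal.toReal_pos hPs (measure_ne_top _ _)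
    obtain ⟨n, hn⟩ := exists_nat_gt (K.toReal / P.real s)
    rw [div_lt_iff₀ hpos] at hn
    have h1 := h (s.indicator fun _ ↦ (n : ℝ)) (measurable_const.indicator hs) n fun x ↦ by
      by_cases hx : x ∈ s <;> simp [hx]
    have h2 : ∫ x, Real.exp (s.indicator (fun _ ↦ (n : ℝ)) x) ∂Q = 1 := by
      have : (fun x ↦ Real.exp (s.indicator (fun _ ↦ (n : ℝ)) x)) =ᵐ[Q] fun _ ↦ 1 := by
        filter_upwards [measure_eq_zero_iff_ae_notMem.1 hQs] with x hx
        simp [hx]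
      rw [integral_congr_ae this]
      simp
    rw [h2, integral_indicator_const _ hs, ENNReal.ofReal_le_iff_le_toReal hK] at h1
    simp only [smul_eq_mul] at h1
    linarith
  set g : α → ℝ := fun x ↦ (P.rnDeriv Q x).toReal with hg
  have hgm : Measurable g := (Measure.measurable_rnDeriv P Q).ennreal_toReal
  have hg0 : ∀ x, 0 ≤ g x := fun x ↦ ENNReal.toReal_nonneg
  set ψ : ℕ → α → ℝ := fun n x ↦ g x * clampLog n (g x) - Real.exp (clampLog n (g x)) + 1 with hψ
  have hcm : ∀ n, Measurable fun x ↦ clampLog n (g x) := fun n ↦ (measurable_clampLog n).comp hgm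
  have hψm : ∀ n, Measurable (ψ n) := fun n ↦
    ((hgm.mul (hcm n)).sub (Real.measurable_exp.comp (hcm n))).add_const 1
  rw [klDiv_eq_lintegral_klFun_of_ac hac]
  have hlim : ∀ x, ENNReal.ofReal (klFun (g x))
      = Filter.liminf (fun n ↦ ENNReal.ofReal (ψ n x)) Filter.atTop := fun x ↦
    ((ENNReal.continuous_ofReal.tendsto _).comp
      (tendsto_mul_clampLog_sub_exp (hg0 x))).liminf_eq.symm
  calc ∫⁻ x, ENNReal.ofReal (klFun (g x)) ∂Q
      = ∫⁻ x, Filter.liminf (fun n ↦ ENNReal.ofReal (ψ n x)) Filter.atTop ∂Q := by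
        simp_rw [hlim]
    _ ≤ Filter.liminf (fun n ↦ ∫⁻ x, ENNReal.ofReal (ψ n x) ∂Q) Filter.atTop :=
        lintegral_liminf_le fun n ↦ (hψm n).ennreal_ofReal
    _ ≤ Filter.liminf (fun _ : ℕ ↦ K) Filter.atTop := by
        refine Filter.liminf_le_liminf (.of_forall fun n ↦ ?_)
        have hb : ∀ x, |clampLog n (g x)| ≤ n := fun x ↦ abs_clampLog_le n _
        have hP := integrable_of_bound (P := P) (hcm n) hb
        have hQ := integrable_exp_of_bound (P := Q) (hcm n) hb
        have hI : Integrable (fun x ↦ g x * clampLog n (g x)) Q := by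
          simpa using (integrable_rnDeriv_smul_iff hac).2 hP
        have h1 : ∫ x, clampLog n (g x) ∂P = ∫ x, g x * clampLog n (g x) ∂Q := by
          simpa using (integral_rnDeriv_smul hac (f := fun x ↦ clampLog n (g x))).symm
        have hS : Integrable (fun x ↦ g x * clampLog n (g x) - Real.exp (clampLog n (g x))) Q :=
          hI.sub hQ
        rw [← ofReal_integral_eq_lintegral_ofReal (f := ψ n) (hS.add (integrable_const _))
          (ae_of_all _ fun x ↦ mul_clampLog_sub_exp_nonneg n (hg0 x))]
        refine le_trans (le_of_eq ?_) (h _ (hcm n) n hb)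
        congr 1
        rw [hψ, integral_add hS (integrable_const _), integral_sub hI hQ, h1]
        simp
    _ = K := Filter.liminf_const K

lemma abs_integral_le_of_bound (P : Measure α) [IsProbabilityMeasure P] {f : α → ℝ} {C : ℝ}
    (hC : ∀ x, |f x| ≤ C) : |∫ x, f x ∂P| ≤ C := by
  simpa using norm_integral_le_of_norm_le_const (μ := P)
    (ae_of_all _ fun x ↦ (Real.norm_eq_abs _).trans_le (hC x))

lemma abs_log_integral_exp_le_of_bound (P : Measure α) [IsProbabilityMeasure P] {f : α → ℝ}
    (hf : Measurable f) {C : ℝ} (hC : ∀ x, |f x| ≤ C) :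
    |Real.log (∫ x, Real.exp (f x) ∂P)| ≤ C := by
  have hint := integrable_exp_of_bound (P := P) hf hC
  have hpos : 0 < ∫ x, Real.exp (f x) ∂P := integral_exp_pos hint
  rw [abs_le, Real.le_log_iff_exp_le hpos, Real.log_le_iff_le_exp hpos]
  constructor
  · calc Real.exp (-C) = ∫ _, Real.exp (-C) ∂P := by simp
      _ ≤ _ := integral_mono (integrable_const _) hint fun x ↦
        Real.exp_le_exp.2 (abs_le.1 (hC x)).1
  · calc _ ≤ ∫ _, Real.exp C ∂P := integral_mono hint (integrable_const _) fun x ↦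
        Real.exp_le_exp.2 (abs_le.1 (hC x)).2
      _ = _ := by simp

lemma integral_kernel_comp {β : Type*} [MeasurableSpace β] {P : Measure α} [SFinite P]
    (κ : Kernel α β) [IsSFiniteKernel κ] {f : β → ℝ} (hf : Integrable f (κ ∘ₘ P)) :
    ∫ y, f y ∂(κ ∘ₘ P) = ∫ x, ∫ y, f y ∂κ x ∂P := by
  rw [← Measure.snd_compProd, Measure.snd] at hf ⊢
  rw [integral_map measurable_snd.aemeasurable hf.aestronglyMeasurable]
  exact Measure.integral_compProd (hf.comp_measurable measurable_snd)

/-- The shifted chain rule for kernels. -/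
theorem klDiv_comp_le_add_lintegral_coupling {β : Type*} [MeasurableSpace β]
    {P T Q : Measure α} [IsProbabilityMeasure P] [IsProbabilityMeasure T] [IsProbabilityMeasure Q]
    (κ η : Kernel α β) [IsMarkovKernel κ] [IsMarkovKernel η] {γ : Measure (α × α)}
    (hγ : γ ∈ couplings P T) :
    klDiv (κ ∘ₘ P) (η ∘ₘ Q) ≤ klDiv T Q + ∫⁻ p, klDiv (κ p.1) (η p.2) ∂γ := by
  have := hγ.1
  refine klDiv_le_of_forall_ofReal_le _ _ fun f hf C hC ↦ ?_
  set a : α → ℝ := fun x ↦ ∫ y, f y ∂κ x with ha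
  set b : α → ℝ := fun x ↦ ∫ y, Real.exp (f y) ∂η x with hb
  have ham : Measurable a := (hf.stronglyMeasurable.integral_kernel (κ := κ)).measurable
  have hbm : Measurable b := ((Real.measurable_exp.comp hf).stronglyMeasurable.integral_kernel
    (κ := η)).measurable
  have hbpos : ∀ x, 0 < b x := fun x ↦ integral_exp_pos (integrable_exp_of_bound hf hC)
  have haC : ∀ x, |a x| ≤ C := fun x ↦ abs_integral_le_of_bound _ hC
  have hcC : ∀ x, |Real.log (b x)| ≤ C := fun x ↦ abs_log_integral_exp_le_of_bound _ hf hC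
  have hcm : Measurable fun x ↦ Real.log (b x) := Real.measurable_log.comp hbm
  have hiP : Integrable (fun p : α × α ↦ a p.1) γ :=
    integrable_of_bound (ham.comp measurable_fst) fun p ↦ haC p.1
  have hiR : Integrable (fun p : α × α ↦ Real.log (b p.2)) γ :=
    integrable_of_bound (hcm.comp measurable_snd) fun p ↦ hcC p.2
  have h1 : ∫ y, f y ∂(κ ∘ₘ P) = ∫ p, a p.1 ∂γ := by
    rw [integral_kernel_comp κ (integrable_of_bound hf hC)]
    simp_rw [← hγ.2.1]
    rw [integral_map measurable_fst.aemeasurable ham.aestronglyMeasurable]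
  have h2 : ∫ y, Real.exp (f y) ∂(η ∘ₘ Q) = ∫ x, Real.exp (Real.log (b x)) ∂Q := by
    rw [integral_kernel_comp η (integrable_exp_of_bound hf hC)]
    simp_rw [fun x ↦ Real.exp_log (hbpos x), hb]
  have h3 : ∫ x, Real.log (b x) ∂T = ∫ p, Real.log (b p.2) ∂γ := by
    simp_rw [← hγ.2.2]
    rw [integral_map measurable_snd.aemeasurable hcm.aestronglyMeasurable]
  -- `log b` is bounded by `C` like `f`, hence an admissible test function.
  have h4 := ofReal_integral_sub_integral_exp_le_klDiv T Q hcm hcC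
  have hiS : Integrable (fun p : α × α ↦ a p.1 - Real.log (b p.2)) γ := hiP.sub hiR
  have h5 : ENNReal.ofReal (∫ p, (a p.1 - Real.log (b p.2)) ∂γ)
      ≤ ∫⁻ p, klDiv (κ p.1) (η p.2) ∂γ := by
    -- Only monotonicity of the lower integral is used, so `p ↦ klDiv (κ p.1) (η p.2)` need not be
    -- measurable.
    refine (ENNReal.ofReal_le_of_le_toReal ?_).trans (lintegral_mono fun p ↦
      ofReal_integral_sub_log_integral_exp_le_klDiv (κ p.1) (η p.2) hf hC)
    rw [integral_eq_lintegral_pos_part_sub_lintegral_neg_part hiS]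
    exact sub_le_self _ ENNReal.toReal_nonneg
  calc ENNReal.ofReal (∫ y, f y ∂(κ ∘ₘ P) - ∫ y, Real.exp (f y) ∂(η ∘ₘ Q) + 1)
      = ENNReal.ofReal ((∫ x, Real.log (b x) ∂T - ∫ x, Real.exp (Real.log (b x)) ∂Q + 1)
        + ∫ p, (a p.1 - Real.log (b p.2)) ∂γ) := by
        rw [h1, h2, h3, integral_sub hiP hiR]
        congr 1
        ring
    _ ≤ _ := ENNReal.ofReal_add_le.trans (add_le_add h4 h5)

end KullbackLeibler

/-! ### Hölder duality for the integral of the `q`-th power of the density -/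

section Hellinger

variable {α β : Type*} [MeasurableSpace α] [MeasurableSpace β]

lemma lintegral_rpow_le_of_one_lt {P Q : Measure α} [SigmaFinite P] [SigmaFinite Q]
    (hPQ : P ≪ Q) {q : ℝ} (hq : 1 < q) {f : α → ℝ≥0∞} (hf : Measurable f) :
    ∫⁻ x, f x ^ (1 - q⁻¹) ∂P
      ≤ (∫⁻ x, P.rnDeriv Q x ^ q ∂Q) ^ q⁻¹ * (∫⁻ x, f x ∂Q) ^ (1 - q⁻¹) := by
  have hq0 : 0 < q := by linarith
  rw [← lintegral_rnDeriv_mul hPQ (hf.pow_const _).aemeasurable]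
  have h := ENNReal.lintegral_mul_norm_pow_le (μ := Q)
    ((Measure.measurable_rnDeriv P Q).pow_const q).aemeasurable hf.aemeasurable
    (p := q⁻¹) (q := 1 - q⁻¹) (by positivity) (sub_nonneg.2 (inv_le_one_of_one_le₀ hq.le))
    (by ring)
  simpa only [← ENNReal.rpow_mul, mul_inv_cancel₀ hq0.ne', ENNReal.rpow_one] using h

/-- Equality in Hölder holds at `f = (dP/dQ)^q`. Truncating the density at `n` makes the integral
finite, so a power of it can be cancelled; monotone convergence removes the truncation. -/
lemma lintegral_rnDeriv_rpow_le_of_forall {P Q : Measure α} [IsFiniteMeasure P] [IsFiniteMeasure Q]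
    {q : ℝ} (hq : 1 < q) {K : ℝ≥0∞} (hPQ : P ≪ Q)
    (h : ∀ f : α → ℝ≥0∞, Measurable f →
      ∫⁻ x, f x ^ (1 - q⁻¹) ∂P ≤ K ^ q⁻¹ * (∫⁻ x, f x ∂Q) ^ (1 - q⁻¹)) :
    ∫⁻ x, P.rnDeriv Q x ^ q ∂Q ≤ K := by
  have hq0 : 0 < q := by linarith
  set g := P.rnDeriv Q with hg
  have hgm : Measurable g := Measure.measurable_rnDeriv P Q
  have hlim : ∀ x, g x ^ q = ⨆ n : ℕ, (min (g x) n) ^ q := fun x ↦ by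
    have h1 : ⨆ n : ℕ, min (g x) (n : ℝ≥0∞) = g x := by
      rw [← inf_iSup_eq, ENNReal.iSup_natCast, inf_top_eq]
    have h2 := (ENNReal.orderIsoRpow q hq0).map_iSup fun n : ℕ ↦ min (g x) (n : ℝ≥0∞)
    simpa only [h1, ENNReal.orderIsoRpow_apply] using h2
  simp_rw [hlim]
  rw [lintegral_iSup (fun n ↦ (hgm.min measurable_const).pow_const q)]
  · refine iSup_le fun n ↦ ?_
    set A := ∫⁻ x, (min (g x) (n : ℝ≥0∞)) ^ q ∂Q with hA
    have hAtop : A ≠ ∞ := by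
      refine ne_top_of_le_ne_top (b := ∫⁻ _, (n : ℝ≥0∞) ^ q ∂Q) ?_
        (lintegral_mono fun x ↦ ENNReal.rpow_le_rpow (min_le_right _ _) hq0.le)
      rw [lintegral_const]
      exact ENNReal.mul_ne_top (ENNReal.rpow_ne_top_of_nonneg hq0.le (by simp)) (measure_ne_top _ _)
    have h1 := h (fun x ↦ (min (g x) (n : ℝ≥0∞)) ^ q) ((hgm.min measurable_const).pow_const q)
    have h2 : A ≤ ∫⁻ x, ((min (g x) (n : ℝ≥0∞)) ^ q) ^ (1 - q⁻¹) ∂P := by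
      rw [← lintegral_rnDeriv_mul hPQ
        (((hgm.min measurable_const).pow_const q).pow_const _).aemeasurable]
      refine lintegral_mono fun x ↦ ?_
      rw [← ENNReal.rpow_mul, mul_sub, mul_inv_cancel₀ hq0.ne', mul_one]
      calc (min (g x) (n : ℝ≥0∞)) ^ q
          = min (g x) (n : ℝ≥0∞) * (min (g x) (n : ℝ≥0∞)) ^ (q - 1) := by
            conv_rhs => rw [← ENNReal.rpow_one (min (g x) (n : ℝ≥0∞)), ← ENNReal.rpow_mul, one_mul]
            rw [← ENNReal.rpow_add_of_nonneg _ _ zero_le_one (by linarith)]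
            congr 1
            ring
        _ ≤ _ := by gcongr; exact min_le_left _ _
    have h3 := h2.trans h1
    rcases eq_or_ne A 0 with h0 | h0
    · simp [h0]
    have hinv : A ^ (1 - q⁻¹) ≠ 0 := by simp [h0, hAtop]
    have hinv' : A ^ (1 - q⁻¹) ≠ ∞ := by simp [h0, hAtop]
    have h4 : A ^ q⁻¹ * A ^ (1 - q⁻¹) ≤ K ^ q⁻¹ * A ^ (1 - q⁻¹) := by
      rwa [← ENNReal.rpow_add _ _ h0 hAtop, add_sub_cancel, ENNReal.rpow_one]
    exact (ENNReal.rpow_le_rpow_iff (by positivity)).1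
      ((ENNReal.mul_le_mul_iff_left hinv hinv').1 h4)
  · intro m n hmn x
    exact ENNReal.rpow_le_rpow (min_le_min_left _ (by exact_mod_cast hmn)) hq0.le

lemma absolutelyContinuous_comp_of_coupling {P T Q : Measure α} {κ η : Kernel α β}
    {γ : Measure (α × α)} (hγ : γ ∈ couplings P T) (hTQ : T ≪ Q)
    (h : ∀ᵐ p ∂γ, κ p.1 ≪ η p.2) : κ ∘ₘ P ≪ η ∘ₘ Q := by
  refine Measure.AbsolutelyContinuous.mk fun s hs hQs ↦ ?_
  have h1 : ∀ᵐ x ∂Q, η x s = 0 := by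
    rwa [Measure.bind_apply hs η.aemeasurable, lintegral_eq_zero_iff (η.measurable_coe hs)] at hQs
  rw [Measure.bind_apply hs κ.aemeasurable, ← lintegral_fst_coupling hγ (κ.measurable_coe hs),
    lintegral_eq_zero_iff (f := fun p : α × α ↦ κ p.1 s)
      ((κ.measurable_coe hs).comp measurable_fst)]
  filter_upwards [h, ae_snd_coupling hγ (hTQ.ae_le h1)] with p hp hp' using hp hp'

theorem lintegral_rnDeriv_comp_rpow_le {P T Q : Measure α} [IsProbabilityMeasure P]
    [IsProbabilityMeasure T] [IsProbabilityMeasure Q] {κ η : Kernel α β} [IsMarkovKernel κ]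
    [IsMarkovKernel η] {γ : Measure (α × α)} (hγ : γ ∈ couplings P T) (hTQ : T ≪ Q)
    {q : ℝ} (hq : 1 < q) {M : ℝ≥0∞} (hac : ∀ᵐ p ∂γ, κ p.1 ≪ η p.2)
    (hM : ∀ᵐ p ∂γ, ∫⁻ y, (κ p.1).rnDeriv (η p.2) y ^ q ∂η p.2 ≤ M) :
    ∫⁻ y, (κ ∘ₘ P).rnDeriv (η ∘ₘ Q) y ^ q ∂(η ∘ₘ Q) ≤ M * ∫⁻ x, T.rnDeriv Q x ^ q ∂Q := by
  have hq0 : 0 < q := by linarith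
  refine lintegral_rnDeriv_rpow_le_of_forall hq
    (absolutelyContinuous_comp_of_coupling hγ hTQ hac) fun f hf ↦ ?_
  have hηf : Measurable fun x ↦ ∫⁻ y, f y ∂η x := hf.lintegral_kernel
  calc ∫⁻ y, f y ^ (1 - q⁻¹) ∂(κ ∘ₘ P)
      = ∫⁻ p, ∫⁻ y, f y ^ (1 - q⁻¹) ∂κ p.1 ∂γ :=
        (lintegral_kernel_comp_fst_coupling hγ κ (hf.pow_const _)).symm
    _ ≤ ∫⁻ p, M ^ q⁻¹ * (∫⁻ y, f y ∂η p.2) ^ (1 - q⁻¹) ∂γ := by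
        refine lintegral_mono_ae ?_
        filter_upwards [hac, hM] with p hp hpM
        exact (lintegral_rpow_le_of_one_lt hp hq hf).trans (by gcongr)
    _ = M ^ q⁻¹ * ∫⁻ x, (∫⁻ y, f y ∂η x) ^ (1 - q⁻¹) ∂T := by
        rw [lintegral_const_mul (f := fun p : α × α ↦ (∫⁻ y, f y ∂η p.2) ^ (1 - q⁻¹)) _
            ((hηf.comp measurable_snd).pow_const _),
          lintegral_snd_coupling hγ (f := fun x ↦ (∫⁻ y, f y ∂η x) ^ (1 - q⁻¹))
            (hηf.pow_const _)]
    _ ≤ M ^ q⁻¹ * ((∫⁻ x, T.rnDeriv Q x ^ q ∂Q) ^ q⁻¹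
          * (∫⁻ x, ∫⁻ y, f y ∂η x ∂Q) ^ (1 - q⁻¹)) := by
        gcongr
        exact lintegral_rpow_le_of_one_lt hTQ hq hηf
    _ = _ := by
        rw [Measure.lintegral_bind η.aemeasurable hf.aemeasurable,
          ENNReal.mul_rpow_of_nonneg _ _ (inv_nonneg.2 hq0.le), mul_assoc]

/-- Hölder after inserting a power of `f` and its inverse; the conditions on `f` make them cancel.
The singular part of `P` only enlarges the right side. -/
lemma lintegral_rnDeriv_rpow_le_of_lt_one {P Q : Measure α} [SigmaFinite P] [SigmaFinite Q]
    {q : ℝ} (hq0 : 0 < q) (hq1 : q < 1) {f : α → ℝ≥0∞} (hf : Measurable f)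
    (hP : ∀ᵐ x ∂P, f x ≠ 0) (hQ : ∀ᵐ x ∂Q, f x ≠ ∞) :
    ∫⁻ x, P.rnDeriv Q x ^ q ∂Q
      ≤ (∫⁻ x, f x ^ (-((1 - q) / q)) ∂P) ^ q * (∫⁻ x, f x ∂Q) ^ (1 - q) := by
  have hgm : Measurable (P.rnDeriv Q) := Measure.measurable_rnDeriv P Q
  have hφm : Measurable fun x ↦ f x ^ (-((1 - q) / q)) := hf.pow_const _
  have hle := Measure.withDensity_rnDeriv_le P Q
  have h0 : ∀ᵐ x ∂Q, P.rnDeriv Q x ≠ 0 → f x ≠ 0 :=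
    (ae_withDensity_iff hgm).1 (ae_mono hle hP)
  calc ∫⁻ x, P.rnDeriv Q x ^ q ∂Q
      = ∫⁻ x, (P.rnDeriv Q x * f x ^ (-((1 - q) / q))) ^ q * f x ^ (1 - q) ∂Q := by
        refine lintegral_congr_ae ?_
        filter_upwards [h0, hQ] with x hx hxt
        rcases eq_or_ne (P.rnDeriv Q x) 0 with hr | hr
        · simp [hr, hq0]
        · rw [ENNReal.mul_rpow_of_nonneg _ _ hq0.le, ← ENNReal.rpow_mul, mul_assoc,
            ← ENNReal.rpow_add _ _ (hx hr) hxt]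
          have : -((1 - q) / q) * q + (1 - q) = 0 := by field_simp; ring
          rw [this, ENNReal.rpow_zero, mul_one]
    _ ≤ (∫⁻ x, P.rnDeriv Q x * f x ^ (-((1 - q) / q)) ∂Q) ^ q * (∫⁻ x, f x ∂Q) ^ (1 - q) :=
        ENNReal.lintegral_mul_norm_pow_le (hgm.mul hφm).aemeasurable hf.aemeasurable hq0.le
          (by linarith) (by ring)
    _ ≤ _ := by
        refine mul_le_mul_left (ENNReal.rpow_le_rpow ?_ hq0.le) _
        calc _ = ∫⁻ x, f x ^ (-((1 - q) / q)) ∂(Q.withDensity (P.rnDeriv Q)) :=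
              (lintegral_withDensity_eq_lintegral_mul _ hgm hφm).symm
          _ ≤ _ := lintegral_mono' hle le_rfl

lemma le_lintegral_rnDeriv_rpow_of_forall {P Q : Measure α} [SigmaFinite P] [SigmaFinite Q]
    {q : ℝ} (hq0 : 0 < q) (hq1 : q < 1) {K : ℝ≥0∞}
    (h : ∀ f : α → ℝ≥0∞, Measurable f → (∀ᵐ x ∂P, f x ≠ 0) → (∀ᵐ x ∂Q, f x ≠ ∞) →
      K ≤ (∫⁻ x, f x ^ (-((1 - q) / q)) ∂P) ^ q * (∫⁻ x, f x ∂Q) ^ (1 - q)) :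
    K ≤ ∫⁻ x, P.rnDeriv Q x ^ q ∂Q := by
  classical
  have hgm : Measurable (P.rnDeriv Q) := Measure.measurable_rnDeriv P Q
  have hms := (Measure.mutuallySingular_singularPart P Q).symm
  set N := hms.nullSet with hN
  have hNm : MeasurableSet N := hms.measurableSet_nullSet
  have hS : ∀ᵐ x ∂(P.singularPart Q), x ∉ Nᶜ :=
    measure_eq_zero_iff_ae_notMem.1 hms.measure_compl_nullSet
  have hQN : ∀ᵐ x ∂Q, x ∈ Nᶜ :=
    measure_eq_zero_iff_ae_notMem.1 hms.measure_nullSet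
  -- The equality case, set to `∞` on the `Q`-null set carrying the singular part: its negative
  -- power vanishes there.
  set f : α → ℝ≥0∞ := fun x ↦ if x ∈ N then ∞ else P.rnDeriv Q x ^ q with hf
  have hfm : Measurable f := Measurable.ite hNm measurable_const (hgm.pow_const q)
  have hfQ : f =ᵐ[Q] fun x ↦ P.rnDeriv Q x ^ q := by
    filter_upwards [hQN] with x hx
    have : x ∉ N := hx
    simp [hf, this]
  have hdec := (Measure.singularPart_add_rnDeriv P Q)
  have hfP : ∀ᵐ x ∂P, f x ≠ 0 := by
    rw [← hdec, ae_add_measure_iff, ae_withDensity_iff hgm]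
    constructor
    · filter_upwards [hS] with x hx
      have : x ∈ N := not_not.1 hx
      simp [hf, this]
    · filter_upwards [hfQ] with x hx hx0
      rw [hx]
      simp [hx0, hq0.not_gt]
  have hft : ∀ᵐ x ∂Q, f x ≠ ∞ := by
    filter_upwards [hfQ, Measure.rnDeriv_lt_top P Q] with x hx hxt
    rw [hx]
    exact ENNReal.rpow_ne_top_of_nonneg hq0.le hxt.ne
  have hexp : -((1 - q) / q) < 0 := by
    have : 0 < (1 - q) / q := div_pos (by linarith) hq0
    linarith
  have hφ : ∫⁻ x, f x ^ (-((1 - q) / q)) ∂P = ∫⁻ x, P.rnDeriv Q x ^ q ∂Q := by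
    conv_lhs => rw [← hdec]
    rw [lintegral_add_measure, lintegral_withDensity_eq_lintegral_mul _ hgm (hfm.pow_const _)]
    have h1 : ∫⁻ x, f x ^ (-((1 - q) / q)) ∂(P.singularPart Q) = 0 := by
      rw [lintegral_eq_zero_iff (hfm.pow_const _)]
      filter_upwards [hS] with x hx
      have : x ∈ N := not_not.1 hx
      simp only [hf, this, if_true, Pi.zero_apply]
      exact ENNReal.top_rpow_of_neg hexp
    rw [h1, zero_add]
    refine lintegral_congr_ae ?_
    filter_upwards [hfQ, Measure.rnDeriv_lt_top P Q] with x hx hxt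
    simp only [Pi.mul_apply, hx]
    rcases eq_or_ne (P.rnDeriv Q x) 0 with hr | hr
    · simp [hr, hq0]
    · rw [← ENNReal.rpow_mul]
      nth_rewrite 1 [← ENNReal.rpow_one (P.rnDeriv Q x)]
      rw [← ENNReal.rpow_add _ _ hr hxt.ne]
      congr 1
      field_simp
      ring
  have := h f hfm hfP hft
  rw [hφ, lintegral_congr_ae hfQ, ← ENNReal.rpow_add_of_nonneg _ _ hq0.le (by linarith)] at this
  simpa using this

theorem le_lintegral_rnDeriv_comp_rpow {P T Q : Measure α} [IsProbabilityMeasure P]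
    [IsProbabilityMeasure T] [IsProbabilityMeasure Q] {κ η : Kernel α β} [IsMarkovKernel κ]
    [IsMarkovKernel η] {γ : Measure (α × α)} (hγ : γ ∈ couplings P T) (hTQ : T ≪ Q)
    {q : ℝ} (hq0 : 0 < q) (hq1 : q < 1) {m : ℝ≥0∞}
    (hm : ∀ᵐ p ∂γ, m ≤ ∫⁻ y, (κ p.1).rnDeriv (η p.2) y ^ q ∂η p.2) :
    m * ∫⁻ x, T.rnDeriv Q x ^ q ∂Q ≤ ∫⁻ y, (κ ∘ₘ P).rnDeriv (η ∘ₘ Q) y ^ q ∂(η ∘ₘ Q) := by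
  refine le_lintegral_rnDeriv_rpow_of_forall hq0 hq1 fun f hf hP hQ ↦ ?_
  set r := T.rnDeriv Q with hr
  have hrm : Measurable r := Measure.measurable_rnDeriv T Q
  set e := -((1 - q) / q) with he
  have hηf : Measurable fun x ↦ ∫⁻ y, f y ∂η x := hf.lintegral_kernel
  have hκf : Measurable fun x ↦ ∫⁻ y, f y ^ e ∂κ x := (hf.pow_const e).lintegral_kernel
  have h1 : ∀ᵐ p ∂γ, m ≤ (∫⁻ y, f y ^ e ∂κ p.1) ^ q * (∫⁻ y, f y ∂η p.2) ^ (1 - q) := by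
    filter_upwards [hm, ae_fst_coupling hγ (Measure.ae_ae_of_ae_comp hP),
      ae_snd_coupling hγ (hTQ.ae_le (Measure.ae_ae_of_ae_comp hQ))] with p hp hpP hpQ
    exact hp.trans (lintegral_rnDeriv_rpow_le_of_lt_one hq0 hq1 hf hpP hpQ)
  have h2 : ∫⁻ x, r x ^ q ∂Q = ∫⁻ p, r p.2 ^ (q - 1) ∂γ := by
    rw [lintegral_snd_coupling hγ (f := fun x ↦ r x ^ (q - 1)) (hrm.pow_const _),
      ← lintegral_rnDeriv_mul hTQ (hrm.pow_const _).aemeasurable]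
    refine lintegral_congr_ae ?_
    filter_upwards [Measure.rnDeriv_lt_top T Q] with x hxt
    rcases eq_or_ne (r x) 0 with h0 | h0
    · simp [h0, hq0, ← hr]
    · rw [← hr]
      nth_rewrite 2 [← ENNReal.rpow_one (r x)]
      rw [← ENNReal.rpow_add _ _ h0 hxt.ne]
      congr 1
      ring
  calc m * ∫⁻ x, r x ^ q ∂Q
      = ∫⁻ p, m * r p.2 ^ (q - 1) ∂γ := by
        rw [h2, lintegral_const_mul (f := fun p : α × α ↦ r p.2 ^ (q - 1)) _
          ((hrm.comp measurable_snd).pow_const _)]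
    -- The weight `r ^ (q - 1)` is absorbed as `r⁻¹` inside the second factor, so that after Hölder
    -- `r⁻¹ dT ≤ dQ`.
    _ ≤ ∫⁻ p, (∫⁻ y, f y ^ e ∂κ p.1) ^ q * ((∫⁻ y, f y ∂η p.2) * (r p.2)⁻¹) ^ (1 - q) ∂γ := by
        refine lintegral_mono_ae ?_
        filter_upwards [h1] with p hp
        rw [ENNReal.mul_rpow_of_nonneg _ _ (by linarith : 0 ≤ 1 - q), ENNReal.inv_rpow,
          ← ENNReal.rpow_neg, neg_sub, ← mul_assoc]
        gcongr
    _ ≤ (∫⁻ p, ∫⁻ y, f y ^ e ∂κ p.1 ∂γ) ^ q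
          * (∫⁻ p, (∫⁻ y, f y ∂η p.2) * (r p.2)⁻¹ ∂γ) ^ (1 - q) :=
        ENNReal.lintegral_mul_norm_pow_le (hκf.comp measurable_fst).aemeasurable
          ((hηf.comp measurable_snd).mul (hrm.comp measurable_snd).inv).aemeasurable hq0.le
          (by linarith) (by ring)
    _ ≤ _ := by
        rw [lintegral_kernel_comp_fst_coupling hγ κ (hf.pow_const e)]
        refine mul_le_mul_right (ENNReal.rpow_le_rpow ?_ (by linarith)) _
        rw [lintegral_snd_coupling hγ (f := fun x ↦ (∫⁻ y, f y ∂η x) * (r x)⁻¹)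
            (hηf.mul hrm.inv), ← lintegral_rnDeriv_mul hTQ
            (f := fun x ↦ (∫⁻ y, f y ∂η x) * (r x)⁻¹) (hηf.mul hrm.inv).aemeasurable,
          Measure.lintegral_bind η.aemeasurable hf.aemeasurable]
        refine lintegral_mono fun x ↦ ?_
        rw [← hr, mul_left_comm]
        exact (mul_le_mul_right (ENNReal.mul_inv_le_one _) _).trans_eq (mul_one _)

end Hellinger

/-! ### Rényi divergences and the shifted composition rule -/

section Renyi

variable {α β : Type*} [MeasurableSpace α] [MeasurableSpace β]

/-- `dP/dQ` is `Q`-a.e. the quotient of the densities, and `1 - q > 0` kills the points where that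
of `Q` vanishes. Thus both branches of `renyiDiv` agree for `q < 1`. -/
lemma lintegral_rnDeriv_add_rpow_mul (P Q : Measure α) [SigmaFinite P] [SigmaFinite Q]
    {q : ℝ} (hq0 : 0 < q) (hq1 : q < 1) :
    ∫⁻ x, P.rnDeriv (P + Q) x ^ q * Q.rnDeriv (P + Q) x ^ (1 - q) ∂(P + Q)
      = ∫⁻ x, P.rnDeriv Q x ^ q ∂Q := by
  have hac : Q ≪ P + Q := Measure.AbsolutelyContinuous.rfl.add_right' P
  rw [lintegral_congr_ae ((P.rnDeriv_eq_div_rnDeriv_add Q).mono fun x hx ↦ by rw [hx]),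
    ← lintegral_rnDeriv_mul hac
      (f := fun x ↦ (P.rnDeriv (P + Q) x / Q.rnDeriv (P + Q) x) ^ q) (by fun_prop)]
  refine lintegral_congr_ae ?_
  filter_upwards [Q.rnDeriv_lt_top (P + Q)] with x hx
  rcases eq_or_ne (Q.rnDeriv (P + Q) x) 0 with h0 | h0
  · simp [h0, hq1]
  · rw [ENNReal.div_rpow_of_nonneg _ _ hq0.le, div_eq_mul_inv, mul_left_comm, ← ENNReal.rpow_neg,
      sub_eq_add_neg, ENNReal.rpow_add _ _ h0 hx.ne, ENNReal.rpow_one]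

lemma renyiDiv_of_lt_one (P Q : Measure α) [SigmaFinite P] [SigmaFinite Q] {q : ℝ≥0∞}
    (hq0 : 0 < q) (hq1 : q < 1) :
    renyiDiv q P Q = (((q.toReal - 1)⁻¹ : ℝ) : EReal)
      * ENNReal.log (∫⁻ x, P.rnDeriv Q x ^ q.toReal ∂Q) := by
  have hqt : q ≠ ∞ := (hq1.trans ENNReal.one_lt_top).ne
  have h1 : q.toReal < 1 := by simpa using (ENNReal.toReal_lt_toReal hqt ENNReal.one_ne_top).2 hq1
  rw [renyiDiv, if_neg hq1.ne, if_neg hqt, if_neg hq1.not_gt,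
    lintegral_rnDeriv_add_rpow_mul P Q (ENNReal.toReal_pos hq0.ne' hqt) h1, ite_self]

lemma renyiDiv_of_one_lt {P Q : Measure α} (hPQ : P ≪ Q) {q : ℝ≥0∞} (hq1 : 1 < q) (hqt : q ≠ ∞) :
    renyiDiv q P Q = (((q.toReal - 1)⁻¹ : ℝ) : EReal)
      * ENNReal.log (∫⁻ x, P.rnDeriv Q x ^ q.toReal ∂Q) := by
  rw [renyiDiv, if_neg hq1.ne', if_neg hqt, if_pos hPQ]

lemma absolutelyContinuous_of_renyiDiv_ne_top {P Q : Measure α} {q : ℝ≥0∞} (hq1 : 1 < q)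
    (h : renyiDiv q P Q ≠ ⊤) : P ≪ Q := by
  by_contra hPQ
  apply h
  by_cases hqt : q = ∞ <;> simp [renyiDiv, hq1, hq1.ne', hqt, hPQ]

lemma renyiDiv_top {P Q : Measure α} (hPQ : P ≪ Q) :
    renyiDiv ∞ P Q = ENNReal.log (essSup (P.rnDeriv Q) Q) := by
  simp [renyiDiv, hPQ]

lemma measure_le_essSup_rnDeriv_mul {P Q : Measure α} [SigmaFinite P] [SigmaFinite Q]
    (hPQ : P ≪ Q) (s : Set α) : P s ≤ essSup (P.rnDeriv Q) Q * Q s := by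
  rw [← Measure.setLIntegral_rnDeriv hPQ s, ← setLIntegral_const]
  exact lintegral_mono_ae (ae_restrict_of_ae (ENNReal.ae_le_essSup _))

lemma essSup_rnDeriv_le_of_forall {P Q : Measure α} [SigmaFinite Q] {K : ℝ≥0∞}
    (h : ∀ s, MeasurableSet s → P s ≤ K * Q s) : essSup (P.rnDeriv Q) Q ≤ K := by
  refine essSup_le_of_ae_le K (ae_le_of_forall_setLIntegral_le_of_sigmaFinite
    (Measure.measurable_rnDeriv P Q) fun s hs _ ↦ ?_)
  rw [setLIntegral_const]
  exact (Measure.setLIntegral_rnDeriv_le s).trans (h s hs)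

/-- Test the Hölder bounds with `f = 1`, or the set bound with the whole space. This rules out `⊥`
in the sums below. -/
lemma renyiDiv_nonneg (P Q : Measure α) [IsProbabilityMeasure P] [IsProbabilityMeasure Q]
    {q : ℝ≥0∞} (hq0 : 0 < q) : 0 ≤ renyiDiv q P Q := by
  rcases lt_trichotomy q 1 with hq1 | rfl | hq1
  · have hqt : q ≠ ∞ := (hq1.trans ENNReal.one_lt_top).ne
    have h0 := ENNReal.toReal_pos hq0.ne' hqt
    have h1 : q.toReal < 1 := by
      simpa using (ENNReal.toReal_lt_toReal hqt ENNReal.one_ne_top).2 hq1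
    have h2 := lintegral_rnDeriv_rpow_le_of_lt_one (P := P) (Q := Q) h0 h1 (f := fun _ ↦ 1)
      measurable_const (by simp) (by simp)
    rw [renyiDiv_of_lt_one P Q hq0 hq1]
    have h3 : ENNReal.log (∫⁻ x, P.rnDeriv Q x ^ q.toReal ∂Q) ≤ 0 := by simpa using h2
    have h4 := EReal.mul_le_mul_of_nonpos_right h3 (c := (((q.toReal - 1)⁻¹ : ℝ) : EReal))
      (by exact_mod_cast inv_nonpos.2 (by linarith))
    rwa [zero_mul, mul_comm] at h4
  · simp [renyiDiv, EReal.coe_ennreal_nonneg]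
  · by_cases htop : renyiDiv q P Q = ⊤
    · simp [htop]
    have hPQ := absolutelyContinuous_of_renyiDiv_ne_top hq1 htop
    by_cases hqt : q = ∞
    · rw [hqt, renyiDiv_top hPQ, ENNReal.zero_le_log_iff]
      simpa using measure_le_essSup_rnDeriv_mul hPQ Set.univ
    have h1 : 1 < q.toReal := by
      simpa using (ENNReal.toReal_lt_toReal ENNReal.one_ne_top hqt).2 hq1
    have h2 := lintegral_rpow_le_of_one_lt hPQ h1 (f := fun _ ↦ 1) measurable_const
    rw [renyiDiv_of_one_lt hPQ hq1 hqt]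
    refine mul_nonneg ?_ ?_
    · exact_mod_cast inv_nonneg.2 (by linarith)
    · rw [ENNReal.zero_le_log_iff]
      simp only [ENNReal.one_rpow, lintegral_const, measure_univ, mul_one] at h2
      have h3 := ENNReal.rpow_le_rpow h2 (zero_le_one.trans h1.le)
      rwa [← ENNReal.rpow_mul, inv_mul_cancel₀ (by linarith), ENNReal.one_rpow,
        ENNReal.rpow_one] at h3

/-- A real first summand excludes `⊤ + ⊥`, where distributivity fails for negative `c`. -/
lemma EReal.coe_mul_coe_add (c a : ℝ) (b : EReal) :
    (c : EReal) * (a + b) = c * a + c * b := by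
  induction b with
  | bot =>
    rcases lt_trichotomy c 0 with h | rfl | h
    · simp [EReal.coe_mul_bot_of_neg h, ← EReal.coe_mul]
    · simp
    · simp [EReal.coe_mul_bot_of_pos h]
  | coe b => norm_cast; ring
  | top =>
    rcases lt_trichotomy c 0 with h | rfl | h
    · simp [EReal.coe_mul_top_of_neg h]
    · simp
    · simp [EReal.coe_mul_top_of_pos h, ← EReal.coe_mul]

lemma EReal.coe_mul_coe_inv_mul {d : ℝ} (hd : d ≠ 0) (x : EReal) :
    (d : EReal) * (((d⁻¹ : ℝ) : EReal) * x) = x := by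
  rw [← mul_assoc, ← EReal.coe_mul, mul_inv_cancel₀ hd, EReal.coe_one, one_mul]

lemma EReal.inv_mul_log_exp_mul {d : ℝ} (hd : d ≠ 0) (s : ℝ) (x : ℝ≥0∞) :
    ((d⁻¹ : ℝ) : EReal) * ENNReal.log (EReal.exp ((d * s : ℝ) : EReal) * x)
      = ((d⁻¹ : ℝ) : EReal) * ENNReal.log x + s := by
  rw [ENNReal.log_mul_add, EReal.log_exp, EReal.coe_mul_coe_add, ← EReal.coe_mul,
    inv_mul_cancel_left₀ hd, add_comm]

/-- The shifted composition rule for kernels. -/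
theorem renyiDiv_comp_le_add_essSup_coupling {P T Q : Measure α} [IsProbabilityMeasure P]
    [IsProbabilityMeasure T] [IsProbabilityMeasure Q] {κ η : Kernel α β} [IsMarkovKernel κ]
    [IsMarkovKernel η] {γ : Measure (α × α)} (hγ : γ ∈ couplings P T) {q : ℝ≥0∞} (hq0 : 0 < q)
    (hTQ : q < 1 → T ≪ Q) :
    renyiDiv q (κ ∘ₘ P) (η ∘ₘ Q)
      ≤ renyiDiv q T Q + essSup (fun p : α × α ↦ renyiDiv q (κ p.1) (η p.2)) γ := by
  have := hγ.1
  have hae : ∀ᵐ p ∂γ, renyiDiv q (κ p.1) (η p.2)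
      ≤ essSup (fun p : α × α ↦ renyiDiv q (κ p.1) (η p.2)) γ := ae_le_essSup
  set S := essSup (fun p : α × α ↦ renyiDiv q (κ p.1) (η p.2)) γ with hS
  have hS0 : 0 ≤ S := by
    obtain ⟨p, hp⟩ := hae.exists
    exact (renyiDiv_nonneg _ _ hq0).trans hp
  have hR0 : 0 ≤ renyiDiv q T Q := renyiDiv_nonneg _ _ hq0
  by_cases hSt : S = ⊤
  · rw [hSt, EReal.add_top_of_ne_bot (ne_bot_of_le_ne_bot EReal.zero_ne_bot hR0)]
    exact le_top
  by_cases hRt : renyiDiv q T Q = ⊤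
  · rw [hRt, EReal.top_add_of_ne_bot (ne_bot_of_le_ne_bot EReal.zero_ne_bot hS0)]
    exact le_top
  clear_value S
  lift S to ℝ using ⟨hSt, ne_bot_of_le_ne_bot EReal.zero_ne_bot hS0⟩
  rcases lt_trichotomy q 1 with hq1 | rfl | hq1
  · have hqt : q ≠ ∞ := (hq1.trans ENNReal.one_lt_top).ne
    have h0 := ENNReal.toReal_pos hq0.ne' hqt
    have h1 : q.toReal < 1 := by
      simpa using (ENNReal.toReal_lt_toReal hqt ENNReal.one_ne_top).2 hq1
    have hd : q.toReal - 1 ≠ 0 := by linarith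
    rw [renyiDiv_of_lt_one _ _ hq0 hq1, renyiDiv_of_lt_one _ _ hq0 hq1,
      ← EReal.inv_mul_log_exp_mul hd]
    rw [mul_comm, mul_comm _ (ENNReal.log _)]
    refine EReal.mul_le_mul_of_nonpos_right (ENNReal.log_le_log ?_)
      (by exact_mod_cast inv_nonpos.2 (by linarith))
    -- The constant is `m = exp ((q - 1) * S)`; since `q - 1 < 0`, the upper bound `S` becomes a
    -- lower bound on the integrals.
    refine le_lintegral_rnDeriv_comp_rpow hγ (hTQ hq1) h0 h1 ?_
    filter_upwards [hae] with p hp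
    rw [renyiDiv_of_lt_one _ _ hq0 hq1] at hp
    rw [← ENNReal.log_le_log_iff, EReal.log_exp]
    have h2 := EReal.mul_le_mul_of_nonpos_right hp
      (c := ((q.toReal - 1 : ℝ) : EReal)) (by exact_mod_cast (by linarith))
    rwa [mul_comm _ ((q.toReal - 1 : ℝ) : EReal), mul_comm _ ((q.toReal - 1 : ℝ) : EReal),
      EReal.coe_mul_coe_inv_mul hd, ← EReal.coe_mul] at h2
  · simp only [renyiDiv, if_true] at hae ⊢
    have h1 : ∫⁻ p, klDiv (κ p.1) (η p.2) ∂γ ≤ ENNReal.ofReal S := by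
      calc _ ≤ ∫⁻ _, ENNReal.ofReal S ∂γ := by
            refine lintegral_mono_ae ?_
            filter_upwards [hae] with p hp
            rw [← EReal.coe_ennreal_le_coe_ennreal_iff, EReal.coe_ennreal_ofReal,
              max_eq_left (by exact_mod_cast hS0)]
            exact hp
        _ = _ := by simp
    have h2 := (klDiv_comp_le_add_lintegral_coupling κ η (Q := Q) hγ).trans
      (add_le_add le_rfl h1)
    rw [← EReal.coe_ennreal_le_coe_ennreal_iff, EReal.coe_ennreal_add, EReal.coe_ennreal_ofReal,
      max_eq_left (by exact_mod_cast hS0)] at h2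
    exact h2
  replace hTQ := absolutelyContinuous_of_renyiDiv_ne_top hq1 hRt
  have hac : ∀ᵐ p ∂γ, κ p.1 ≪ η p.2 := by
    filter_upwards [hae] with p hp
    exact absolutelyContinuous_of_renyiDiv_ne_top hq1 (ne_top_of_le_ne_top (EReal.coe_ne_top S) hp)
  have hac' := absolutelyContinuous_comp_of_coupling hγ hTQ hac
  by_cases hqt : q = ∞
  · subst hqt
    rw [renyiDiv_top hTQ, renyiDiv_top hac', ← EReal.log_exp (S : EReal), ← ENNReal.log_mul_add]
    refine ENNReal.log_le_log (essSup_rnDeriv_le_of_forall fun s hs ↦ ?_)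
    set M := EReal.exp (S : EReal)
    have hκ : ∀ᵐ p ∂γ, κ p.1 s ≤ M * η p.2 s := by
      filter_upwards [hae, hac] with p hp hpac
      rw [renyiDiv_top hpac, ← EReal.log_exp (S : EReal), ENNReal.log_le_log_iff] at hp
      exact (measure_le_essSup_rnDeriv_mul hpac s).trans (by gcongr)
    have hηm := η.measurable_coe hs
    -- Domination of `T` by a multiple of `Q` transfers the outer integral from `T` to `Q`.
    have hTle : T ≤ essSup (T.rnDeriv Q) Q • Q := Measure.le_iff.2 fun t _ ↦ by
      simpa using measure_le_essSup_rnDeriv_mul hTQ t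
    calc (κ ∘ₘ P) s = ∫⁻ p, κ p.1 s ∂γ := by
          rw [Measure.bind_apply hs κ.aemeasurable, lintegral_fst_coupling hγ (κ.measurable_coe hs)]
      _ ≤ ∫⁻ p, M * η p.2 s ∂γ := lintegral_mono_ae hκ
      _ = M * ∫⁻ x, η x s ∂T := by
          rw [lintegral_snd_coupling hγ (f := fun x ↦ M * η x s) (hηm.const_mul M),
            lintegral_const_mul _ hηm]
      _ ≤ M * ∫⁻ x, η x s ∂(essSup (T.rnDeriv Q) Q • Q) := by
          gcongr
      _ = _ := by
          rw [lintegral_smul_measure, Measure.bind_apply hs η.aemeasurable, smul_eq_mul]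
          ring
  have h1 : 1 < q.toReal := by
    simpa using (ENNReal.toReal_lt_toReal ENNReal.one_ne_top hqt).2 hq1
  have hd : q.toReal - 1 ≠ 0 := by linarith
  rw [renyiDiv_of_one_lt hTQ hq1 hqt, renyiDiv_of_one_lt hac' hq1 hqt,
    ← EReal.inv_mul_log_exp_mul hd]
  refine mul_le_mul_of_nonneg_left (ENNReal.log_le_log ?_)
    (by exact_mod_cast inv_nonneg.2 (by linarith))
  refine lintegral_rnDeriv_comp_rpow_le hγ hTQ h1 hac ?_
  filter_upwards [hae, hac] with p hp hpac
  rw [renyiDiv_of_one_lt hpac hq1 hqt] at hp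
  rw [← ENNReal.log_le_log_iff, EReal.log_exp]
  have h2 := mul_le_mul_of_nonneg_left hp
    (a := ((q.toReal - 1 : ℝ) : EReal)) (by exact_mod_cast (by linarith))
  rwa [EReal.coe_mul_coe_inv_mul hd, ← EReal.coe_mul] at h2

end Renyi

/-- Nonnegativity excludes `⊥`: if `b = ⊤` the bound is trivial, otherwise `b` is real and can be
subtracted, also when `s` is empty. -/
lemma EReal.le_add_iInf₂ {ι : Type*} {s : Set ι} {a b : EReal} {f : ι → EReal} (hb : 0 ≤ b)
    (hf : ∀ i ∈ s, 0 ≤ f i) (h : ∀ i ∈ s, a ≤ b + f i) : a ≤ b + ⨅ i ∈ s, f i := by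
  have hf' : 0 ≤ ⨅ i ∈ s, f i := le_iInf₂ hf
  have hbot : b ≠ ⊥ := ne_bot_of_le_ne_bot EReal.zero_ne_bot hb
  by_cases hbt : b = ⊤
  · rw [hbt, EReal.top_add_of_ne_bot (ne_bot_of_le_ne_bot EReal.zero_ne_bot hf')]
    exact le_top
  rw [add_comm, ← EReal.sub_le_iff_le_add (.inl hbot) (.inl hbt)]
  refine le_iInf₂ fun i hi ↦ ?_
  rw [EReal.sub_le_iff_le_add (.inl hbot) (.inl hbt), add_comm]
  exact h i hi

theorem theorem3p1 {Ω E F : Type*} [MeasurableSpace Ω]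
    [MeasurableSpace E] [StandardBorelSpace E]
    [MeasurableSpace F] [StandardBorelSpace F] [Nonempty F]
    (μ ν : Measure Ω) [IsProbabilityMeasure μ] [IsProbabilityMeasure ν]
    (X X' : Ω → E) (Y : Ω → F)
    (hX : Measurable X) (hX' : Measurable X') (hY : Measurable Y) :
    (klDiv (μ.map Y) (ν.map Y) ≤
      klDiv (μ.map X') (ν.map X) +
        ⨅ γ ∈ couplings (μ.map X) (μ.map X'),
          ∫⁻ p, klDiv (condDistrib Y X μ p.1) (condDistrib Y X ν p.2) ∂γ) ∧
    (∀ q : ℝ≥0∞, 0 < q → (q < 1 → μ.map X' ≪ ν.map X) →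
      renyiDiv q (μ.map Y) (ν.map Y) ≤
        renyiDiv q (μ.map X') (ν.map X) +
          ⨅ γ ∈ couplings (μ.map X) (μ.map X'),
            essSup (fun p : E × E =>
              renyiDiv q (condDistrib Y X μ p.1) (condDistrib Y X ν p.2)) γ) := by
  have := Measure.isProbabilityMeasure_map (μ := μ) hX.aemeasurable
  have := Measure.isProbabilityMeasure_map (μ := μ) hX'.aemeasurable
  have := Measure.isProbabilityMeasure_map (μ := ν) hX.aemeasurable
  rw [← condDistrib_comp_map (μ := μ) hX.aemeasurable hY.aemeasurable,
    ← condDistrib_comp_map (μ := ν) hX.aemeasurable hY.aemeasurable]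
  refine ⟨?_, fun q hq0 hac ↦ ?_⟩
  · simp_rw [ENNReal.add_iInf]
    exact le_iInf₂ fun γ hγ ↦ klDiv_comp_le_add_lintegral_coupling _ _ hγ
  · refine EReal.le_add_iInf₂ (renyiDiv_nonneg _ _ hq0) (fun γ hγ ↦ ?_) fun γ hγ ↦
      renyiDiv_comp_le_add_essSup_coupling hγ hq0 hac
    have := hγ.1
    obtain ⟨p, hp⟩ := (ae_le_essSup (f := fun p : E × E ↦
      renyiDiv q (condDistrib Y X μ p.1) (condDistrib Y X ν p.2)) (μ := γ)).exists
    exact (renyiDiv_nonneg _ _ hq0).trans hp
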